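/- Let $K$ be a field and let $X_\bullet=\{X_t\}_{t\in\mathbb R}$ be a filtration of topological spaces, i.e. spaces with $X_t\subseteq X_s$ (continuous inclusion) for $t\le s$; more generally, $X_\bullet$ may be any functor from $(\mathbb R,\le)$ to topological spaces. Let $\mathbf H^*(X)=\bigoplus_{p\ge 0}\mathbf H^p(X)$ be the singular cohomology ring over $K$ with the cup product, and $\mathbf H^+(X)=\bigoplus_{p\ge 1}\mathbf H^p(X)$. The length $\mathbf{len}(R)\in\mathbb N\cup\{\infty\}$ of a graded ring $R$ is the supremum of all $\ell\ge 0$ such that some product of $\ell$ homogeneous elements of positive degree of $R$ is non-zero (with $\sup\emptyset=0$). The persistent cup-length invariant of $X_\bullet$ is $$\mathbf{cup}(X_\bullet)([a,b])=\mathbf{len}\bigl(\operatorname{im}(\mathbf H^*(X_b)\to\mathbf H^*(X_a))\bigr),\qquad a\le b .$$ A family of representative cocycles $\boldsymbol\sigma=\{\sigma_I\}$ for the barcode of $\mathbf H^+(X_\bullet)$ consists of a multiset of non-empty intervals $I\subseteq\mathbb R$ (the bars), each with a degree $p_I\ge 1$, and of a $p_I$-cocycle $\sigma_I$ for each bar $I$,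 given by cocycles on the spaces $X_t$, $t\in I$, that restrict to each other (if $I$ has a largest element $d$, this is just a cocycle on $X_d$), such that the class of the restriction of $\sigma_I$ to $X_s$ is zero for every $s\notin I$ lying below $I$, and such that for each $t\in\mathbb R$ the classes $[\sigma_I]_t$ of the restrictions to $X_t$, over all bars $I\ni t$, form a linear basis of $\mathbf H^+(X_t)$. For $t\notin I$ put $[\sigma_I]_t:=0$. The support of a product is $$\operatorname{supp}(\sigma_{I_1}\smile\dots\smile\sigma_{I_\ell})=\{t\in\mathbb R : [\sigma_{I_1}]_t\smile\dots\smile[\sigma_{I_\ell}]_t\neq 0\},$$ and the persistent cup-length diagram assigns to an interval $J$ the value $$\mathbf{dgm}(\mathbf{cup}(X_\bullet),\boldsymbol\sigma)(J)=\sup\{\ell\ge 1 : J=\operatorname{supp}(\sigma_{I_1}\smile\dots\smile\sigma_{I_\ell})\text{ for some bars } I_1,\dots,I_\ell\}\in\mathbb N\cup\{\infty\},\qquad \sup\emptyset=0 .$$ Let $\mathcal{I}nt$ be one of the following classes of non-empty intervals of $\mathbb R$, bounded or unbounded: those whose finite left end is always included, or always excluded, or unrestricted, and whose finite right end is always included,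 or always excluded, or unrestricted (this covers the closed-closed, closed-open, open-closed and open-open intervals, and the class of all intervals). Suppose that all bars of $\boldsymbol\sigma$ belong to $\mathcal{I}nt$. **Theorem.** For all real $a\le b$, $$\mathbf{cup}(X_\bullet)([a,b])=\sup_{J\in\mathcal{I}nt,\ J\supseteq[a,b]}\mathbf{dgm}(\mathbf{cup}(X_\bullet),\boldsymbol\sigma)(J),$$ and if $\mathbf{cup}(X_\bullet)([a,b])$ is finite, then the supremum is a maximum: $$\mathbf{cup}(X_\bullet)([a,b])=\max_{J\in\mathcal{I}nt,\ J\supseteq[a,b]}\mathbf{dgm}(\mathbf{cup}(X_\bullet),\boldsymbol\sigma)(J).$$ -/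

import Mathlib

open CategoryTheory

universe u v w

noncomputable section

namespace PersistentCup

open DirectSum Opposite

/-! ### Cochains of a simplicial set and the cup product -/

section Cochains

open scoped Simplicial

/-- The inclusion of the front face `{0, …, p}` of `{0, …, n}`, where `n = p + q`. -/
def frontMap {p q n : ℕ} (h : p + q = n) : ⦋p⦌ ⟶ ⦋n⦌ :=
  SimplexCategory.mkHom
    { toFun := fun i => ⟨i.1, by have := i.2; omega⟩
      monotone' := fun _ _ hij => hij }

/-- The inclusion of the back face `{p, …, n}` of `{0, …, n}`, where `n = p + q`. -/
def backMap {p q n : ℕ} (h : p + q = n) : ⦋q⦌ ⟶ ⦋n⦌ :=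
  SimplexCategory.mkHom
    { toFun := fun j => ⟨p + j.1, by have := j.2; omega⟩
      monotone' := fun _ _ hij => Nat.add_le_add_left hij p }

variable (K : Type v) [Field K] (S : SSet.{u})

/-- The `p`-cochains of `S` with coefficients in `K`: a linear form on the `p`-chains is the same
as a function on the `p`-simplices. -/
abbrev Cochain (p : ℕ) : Type max u v := S _⦋p⦌ → K

variable {S}

/-- The coboundary, `(d f)(τ) = ∑ i, (-1)^i f(∂ᵢ τ)`. -/
def coboundary (p : ℕ) : Cochain K S p →ₗ[K] Cochain K S (p + 1) where
  toFun f τ := ∑ i : Fin (p + 2), (-1 : K) ^ (i : ℕ) * f (S.map (SimplexCategory.δ i).op τ)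
  map_add' f g := by
    funext τ
    simp [mul_add, Finset.sum_add_distrib]
  map_smul' c f := by
    funext τ
    simp only [Pi.smul_apply, smul_eq_mul, RingHom.id_apply, Finset.mul_sum]
    exact Finset.sum_congr rfl fun i _ => by ring

/-- The cup product of cochains, `(f ⌣ g)[τ₀,…,τₙ] = f[τ₀,…,τₚ] · g[τₚ,…,τₙ]`, `n = p + q`. -/
def cupCochain {p q n : ℕ} (h : p + q = n) :
    Cochain K S p →ₗ[K] Cochain K S q →ₗ[K] Cochain K S n :=
  LinearMap.mk₂ K
    (fun f g τ => f (S.map (frontMap h).op τ) * g (S.map (backMap h).op τ))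
    (fun f f' g => by funext τ; simp [add_mul])
    (fun c f g => by funext τ; simp [mul_assoc])
    (fun f g g' => by funext τ; simp [mul_add])
    (fun c f g => by funext τ; simp [mul_left_comm])

theorem cupCochain_apply {p q n : ℕ} (h : p + q = n) (f : Cochain K S p) (g : Cochain K S q)
    (τ : S _⦋n⦌) :
    cupCochain K h f g τ = f (S.map (frontMap h).op τ) * g (S.map (backMap h).op τ) := rfl

theorem map_map_op (S : SSet.{u}) {a b c : SimplexCategory} (f : a ⟶ b) (g : b ⟶ c)
    (τ : S.obj (op c)) : S.map f.op (S.map g.op τ) = S.map (f ≫ g).op τ := by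
  rw [op_comp, S.map_comp]; rfl

theorem simplexHom_ext {a b : ℕ} {f g : ⦋a⦌ ⟶ ⦋b⦌}
    (h : ∀ k : Fin (a + 1), (f.toOrderHom k : Fin (b + 1)).val = (g.toOrderHom k : Fin (b + 1)).val) :
    f = g := by
  apply SimplexCategory.Hom.ext
  ext k
  exact h k

theorem comp_val {a b c : ℕ} (f : ⦋a⦌ ⟶ ⦋b⦌) (g : ⦋b⦌ ⟶ ⦋c⦌) (k : Fin (a + 1)) :
    ((f ≫ g).toOrderHom k : Fin (c + 1)).val = (g.toOrderHom (f.toOrderHom k) : Fin (c + 1)).val :=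
  rfl

/-- The values of the coface map that skips `i`. -/
def skip (i k : ℕ) : ℕ := if k < i then k else k + 1

theorem δ_val {n : ℕ} (i : Fin (n + 2)) (k : Fin (n + 1)) :
    ((SimplexCategory.δ i).toOrderHom k : Fin (n + 2)).val =
      skip i.val k.val := by
  change (i.succAbove k).val = _
  unfold skip Fin.succAbove
  by_cases h : k.val < i.val
  · rw [if_pos h, if_pos (show k.castSucc < i from h)]; rfl
  · rw [if_neg h, if_neg (show ¬ k.castSucc < i from h)]; rfl

theorem frontMap_val {p q n : ℕ} (h : p + q = n) (k : Fin (p + 1)) :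
    ((frontMap h).toOrderHom k : Fin (n + 1)).val = k.val := rfl

theorem backMap_val {p q n : ℕ} (h : p + q = n) (k : Fin (q + 1)) :
    ((backMap h).toOrderHom k : Fin (n + 1)).val = p + k.val := rfl

theorem frontMap_δ_low {p q : ℕ} (i : Fin (p + 1)) :
    frontMap (rfl : p + q = p + q) ≫
        SimplexCategory.δ (⟨i.1, by have := i.2; omega⟩ : Fin (p + q + 2)) =
      SimplexCategory.δ (i.castSucc) ≫ frontMap (by omega : (p + 1) + q = p + q + 1) := by
  refine simplexHom_ext fun k => ?_
  have := k.2
  have := i.2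
  simp only [comp_val, δ_val, frontMap_val, backMap_val, Fin.val_castSucc, Fin.val_succ,
    Fin.val_last, Fin.val_zero]

theorem backMap_δ_low {p q : ℕ} (i : Fin (p + 1)) :
    backMap (rfl : p + q = p + q) ≫
        SimplexCategory.δ (⟨i.1, by have := i.2; omega⟩ : Fin (p + q + 2)) =
      backMap (by omega : (p + 1) + q = p + q + 1) := by
  refine simplexHom_ext fun k => ?_
  have := k.2
  have := i.2
  simp only [comp_val, δ_val, frontMap_val, backMap_val, Fin.val_castSucc, Fin.val_succ,
    Fin.val_last, Fin.val_zero]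
  generalize k.val = kk at *
  unfold skip
  split_ifs <;> omega

theorem frontMap_δ_high {p q : ℕ} (j : Fin (q + 1)) :
    frontMap (rfl : p + q = p + q) ≫
        SimplexCategory.δ (⟨p + 1 + j.1, by have := j.2; omega⟩ : Fin (p + q + 2)) =
      frontMap (by omega : p + (q + 1) = p + q + 1) := by
  refine simplexHom_ext fun k => ?_
  have := k.2
  have := j.2
  simp only [comp_val, δ_val, frontMap_val, backMap_val, Fin.val_castSucc, Fin.val_succ,
    Fin.val_last, Fin.val_zero]
  generalize k.val = kk at *
  unfold skip
  split_ifs <;> omega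

theorem backMap_δ_high {p q : ℕ} (j : Fin (q + 1)) :
    backMap (rfl : p + q = p + q) ≫
        SimplexCategory.δ (⟨p + 1 + j.1, by have := j.2; omega⟩ : Fin (p + q + 2)) =
      SimplexCategory.δ j.succ ≫ backMap (by omega : p + (q + 1) = p + q + 1) := by
  refine simplexHom_ext fun k => ?_
  have := k.2
  have := j.2
  simp only [comp_val, δ_val, frontMap_val, backMap_val, Fin.val_castSucc, Fin.val_succ,
    Fin.val_last, Fin.val_zero]
  generalize k.val = kk at *
  unfold skip
  split_ifs <;> omega

theorem δ_last_frontMap {p q : ℕ} :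
    SimplexCategory.δ (Fin.last (p + 1)) ≫ frontMap (by omega : (p + 1) + q = p + q + 1) =
      frontMap (by omega : p + (q + 1) = p + q + 1) := by
  refine simplexHom_ext fun k => ?_
  have := k.2
  simp only [comp_val, δ_val, frontMap_val, backMap_val, Fin.val_castSucc, Fin.val_succ,
    Fin.val_last, Fin.val_zero]
  generalize k.val = kk at *
  unfold skip
  split_ifs <;> omega

theorem δ_zero_backMap {p q : ℕ} :
    SimplexCategory.δ 0 ≫ backMap (by omega : p + (q + 1) = p + q + 1) =
      backMap (by omega : (p + 1) + q = p + q + 1) := by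
  refine simplexHom_ext fun k => ?_
  have := k.2
  simp only [comp_val, δ_val, frontMap_val, backMap_val, Fin.val_castSucc, Fin.val_succ,
    Fin.val_last, Fin.val_zero]
  generalize k.val = kk at *
  unfold skip
  split_ifs <;> omega

/-- The Leibniz rule. -/
theorem coboundary_cup {p q : ℕ} (f : Cochain K S p) (g : Cochain K S q) :
    coboundary K (p + q) (cupCochain K rfl f g) =
      cupCochain K (by omega : (p + 1) + q = p + q + 1) (coboundary K p f) g +
        (-1 : K) ^ p •
          cupCochain K (by omega : p + (q + 1) = p + q + 1) f (coboundary K q g) := by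
  funext τ
  simp only [coboundary, LinearMap.coe_mk, AddHom.coe_mk, cupCochain_apply, Pi.add_apply,
    Pi.smul_apply, smul_eq_mul, map_map_op]
  rw [← (finCongr (by omega : (p + 1) + (q + 1) = p + q + 2)).sum_comp, Fin.sum_univ_add,
    Fin.sum_univ_castSucc (n := p + 1), Fin.sum_univ_succ (n := q + 1), δ_last_frontMap,
    δ_zero_backMap]
  have h1 : ∀ i : Fin (p + 1),
      (-1 : K) ^ ((finCongr (by omega : (p + 1) + (q + 1) = p + q + 2)
        (Fin.castAdd (q + 1) i) : Fin (p + q + 2)) : ℕ) *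
        (f (S.map (frontMap (rfl : p + q = p + q) ≫ SimplexCategory.δ
          (finCongr (by omega : (p + 1) + (q + 1) = p + q + 2) (Fin.castAdd (q + 1) i))).op τ) *
        g (S.map (backMap (rfl : p + q = p + q) ≫ SimplexCategory.δ
          (finCongr (by omega : (p + 1) + (q + 1) = p + q + 2) (Fin.castAdd (q + 1) i))).op τ)) =
      ((-1 : K) ^ ((i.castSucc : Fin (p + 2)) : ℕ) *
        f (S.map (SimplexCategory.δ i.castSucc ≫
          frontMap (by omega : (p + 1) + q = p + q + 1)).op τ)) *
        g (S.map (backMap (by omega : (p + 1) + q = p + q + 1)).op τ) := by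
    intro i
    rw [← frontMap_δ_low (q := q) i, ← backMap_δ_low (q := q) i, mul_assoc]
    rfl
  have h2 : ∀ j : Fin (q + 1),
      (-1 : K) ^ ((finCongr (by omega : (p + 1) + (q + 1) = p + q + 2)
        (Fin.natAdd (p + 1) j) : Fin (p + q + 2)) : ℕ) *
        (f (S.map (frontMap (rfl : p + q = p + q) ≫ SimplexCategory.δ
          (finCongr (by omega : (p + 1) + (q + 1) = p + q + 2) (Fin.natAdd (p + 1) j))).op τ) *
        g (S.map (backMap (rfl : p + q = p + q) ≫ SimplexCategory.δ
          (finCongr (by omega : (p + 1) + (q + 1) = p + q + 2) (Fin.natAdd (p + 1) j))).op τ)) =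
      (-1 : K) ^ p * (f (S.map (frontMap (by omega : p + (q + 1) = p + q + 1)).op τ) *
        ((-1 : K) ^ ((j.succ : Fin (q + 2)) : ℕ) *
          g (S.map (SimplexCategory.δ j.succ ≫
            backMap (by omega : p + (q + 1) = p + q + 1)).op τ))) := by
    intro j
    rw [← frontMap_δ_high (q := q) j, ← backMap_δ_high (q := q) j]
    have : (-1 : K) ^ (p + 1 + j.1) = (-1) ^ p * (-1) ^ (j.1 + 1) := by
      rw [← pow_add]; congr 1; omega
    change (-1 : K) ^ (p + 1 + j.1) * (_ * _) = (-1 : K) ^ p * (_ * ((-1 : K) ^ (j.1 + 1) * _))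
    rw [this]
    simp only [mul_assoc, mul_left_comm]
    rfl
  rw [Finset.sum_congr rfl fun i _ => h1 i, Finset.sum_congr rfl fun j _ => h2 j, add_mul,
    Finset.sum_mul, mul_add, mul_add, Finset.mul_sum, Finset.mul_sum]
  simp only [Fin.val_last, Fin.val_zero, pow_zero, one_mul, pow_succ]
  ring

end Cochains

/-! ### The cohomology ring -/

section Cohomology

variable (K : Type v) [Field K] (S : SSet.{u})

/-- The `p`-cocycles. -/
def Cocycle (p : ℕ) : Submodule K (Cochain K S p) := LinearMap.ker (coboundary K p)

/-- The `p`-coboundaries. -/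
def Coboundaries : (p : ℕ) → Submodule K (Cochain K S p)
  | 0 => ⊥
  | p + 1 => LinearMap.range (coboundary K p)

open scoped Simplicial

/-- Cohomology in degree `p`: cocycles modulo coboundaries. -/
def Cohomology (p : ℕ) : Type max u v :=
  Cocycle K S p ⧸ (Coboundaries K S p).submoduleOf (Cocycle K S p)

instance (p : ℕ) : AddCommGroup (Cohomology K S p) :=
  inferInstanceAs (AddCommGroup (Cocycle K S p ⧸ (Coboundaries K S p).submoduleOf (Cocycle K S p)))

instance (p : ℕ) : Module K (Cohomology K S p) :=
  inferInstanceAs (Module K (Cocycle K S p ⧸ (Coboundaries K S p).submoduleOf (Cocycle K S p)))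

variable {S}

/-- The cohomology class of a cocycle. -/
def cohClass {p : ℕ} : Cocycle K S p →ₗ[K] Cohomology K S p := Submodule.mkQ _

theorem cohClass_surjective {p : ℕ} : Function.Surjective (cohClass K (S := S) (p := p)) :=
  Submodule.mkQ_surjective _

variable {K}

theorem cohClass_eq_zero {p : ℕ} (z : Cocycle K S p) :
    cohClass K z = 0 ↔ (z : Cochain K S p) ∈ Coboundaries K S p := by
  exact Submodule.Quotient.mk_eq_zero _

theorem cup_mem_cocycle {p q n : ℕ} (h : p + q = n) {f : Cochain K S p} {g : Cochain K S q}
    (hf : f ∈ Cocycle K S p) (hg : g ∈ Cocycle K S q) :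
    cupCochain K h f g ∈ Cocycle K S n := by
  subst h
  have hf' : coboundary K p f = 0 := hf
  have hg' : coboundary K q g = 0 := hg
  simp [Cocycle, LinearMap.mem_ker, coboundary_cup, hf', hg']

theorem cup_mem_left {p q n : ℕ} (h : p + q = n) {f : Cochain K S p} {g : Cochain K S q}
    (hf : f ∈ Coboundaries K S p) (hg : g ∈ Cocycle K S q) :
    cupCochain K h f g ∈ Coboundaries K S n := by
  cases p with
  | zero =>
    have : f = 0 := hf
    simp [this]
  | succ p =>
    obtain ⟨k, rfl⟩ := hf
    obtain rfl : n = p + q + 1 := by omega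
    have hg' : coboundary K q g = 0 := hg
    exact ⟨cupCochain K rfl k g, by simp [coboundary_cup, hg']⟩

theorem cup_mem_right {p q n : ℕ} (h : p + q = n) {f : Cochain K S p} {g : Cochain K S q}
    (hf : f ∈ Cocycle K S p) (hg : g ∈ Coboundaries K S q) :
    cupCochain K h f g ∈ Coboundaries K S n := by
  cases q with
  | zero =>
    have : g = 0 := hg
    simp [this]
  | succ q =>
    obtain ⟨k, rfl⟩ := hg
    obtain rfl : n = p + q + 1 := by omega
    have hf' : coboundary K p f = 0 := hf
    refine ⟨(-1 : K) ^ p • cupCochain K rfl f k, ?_⟩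
    rw [map_smul, coboundary_cup, hf', map_zero, LinearMap.zero_apply, zero_add, smul_smul,
      ← mul_pow]
    simp

variable (K)

/-- The cup product of cocycles. -/
def cupCocycle {p q n : ℕ} (h : p + q = n) :
    Cocycle K S p →ₗ[K] Cocycle K S q →ₗ[K] Cocycle K S n :=
  LinearMap.mk₂ K
    (fun f g => ⟨cupCochain K h f g, cup_mem_cocycle h f.2 g.2⟩)
    (fun f f' g => by ext1; simp)
    (fun c f g => by ext1; simp)
    (fun f g g' => by ext1; simp)
    (fun c f g => by ext1; simp)

/-- The cup product `Hᵖ × H^q → H^(p+q)`, induced by the cup product of cocycles. -/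
def cup {p q n : ℕ} (h : p + q = n) :
    Cohomology K S p →ₗ[K] Cohomology K S q →ₗ[K] Cohomology K S n :=
  Submodule.liftQ _
    (LinearMap.flip (Submodule.liftQ _
      (LinearMap.flip ((cupCocycle K h).compr₂ (cohClass K)))
      (fun g hg => by
        rw [LinearMap.mem_ker]
        ext1 f
        exact (cohClass_eq_zero _).2 (cup_mem_right h f.2 hg))))
    (fun f hf => by
      rw [LinearMap.mem_ker]
      refine LinearMap.ext fun g => ?_
      obtain ⟨g, rfl⟩ := cohClass_surjective K g
      exact (cohClass_eq_zero _).2 (cup_mem_left h hf g.2))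

theorem cup_cohClass {p q n : ℕ} (h : p + q = n) (f : Cocycle K S p) (g : Cocycle K S q) :
    cup K h (cohClass K f) (cohClass K g) = cohClass K (cupCocycle K h f g) := rfl

variable (S)

/-- The unit cocycle, with constant value `1` on the vertices. -/
def oneCocycle : Cocycle K S 0 :=
  ⟨fun _ => 1, by
    change coboundary K 0 (fun _ => 1) = 0
    funext τ
    simp [coboundary, Fin.sum_univ_two]⟩

variable {S K}

theorem mk_cohClass_eq {m n : ℕ} (h : m = n) (f : Cocycle K S m) (g : Cocycle K S n)
    (hfg : ∀ τ : S _⦋n⦌, (f : Cochain K S m) (S.map (eqToHom (by rw [h]) : ⦋m⦌ ⟶ ⦋n⦌).op τ) =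
      (g : Cochain K S n) τ) :
    (GradedMonoid.mk m (cohClass K f) : GradedMonoid (Cohomology K S)) =
      GradedMonoid.mk n (cohClass K g) := by
  subst h
  have : f = g := by
    ext τ
    simpa using hfg τ
  rw [this]

theorem eqToHom_val {m n : ℕ} (h : m = n) (k : Fin (m + 1)) :
    ((eqToHom (by rw [h]) : ⦋m⦌ ⟶ ⦋n⦌).toOrderHom k : Fin (n + 1)).val = k.val := by
  subst h
  rfl

instance : GradedMonoid.GMul (Cohomology K S) where
  mul a b := cup K rfl a b

instance : GradedMonoid.GOne (Cohomology K S) where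
  one := cohClass K (oneCocycle K S)

/-- The graded ring structure given by the cup product. -/
instance : DirectSum.GRing (Cohomology K S) where
  mul_zero a := map_zero _
  zero_mul b := by
    change cup K rfl 0 b = 0
    rw [map_zero, LinearMap.zero_apply]
  mul_add a b c := map_add _ _ _
  add_mul a b c := by
    change cup K rfl (a + b) c = cup K rfl a c + cup K rfl b c
    rw [map_add, LinearMap.add_apply]
  one_mul := by
    rintro ⟨p, a⟩
    obtain ⟨f, rfl⟩ := cohClass_surjective K a
    refine mk_cohClass_eq (zero_add p) (cupCocycle K rfl (oneCocycle K S) f) f fun τ => ?_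
    change 1 * (f : Cochain K S p) _ = _
    rw [one_mul, map_map_op]
    have : backMap (rfl : 0 + p = 0 + p) ≫ eqToHom (by rw [zero_add]) = 𝟙 ⦋p⦌ := by
      refine simplexHom_ext fun k => ?_
      rw [comp_val, eqToHom_val (zero_add p), backMap_val, zero_add]
      rfl
    rw [this]
    simp
  mul_one := by
    rintro ⟨p, a⟩
    obtain ⟨f, rfl⟩ := cohClass_surjective K a
    refine mk_cohClass_eq (add_zero p) (cupCocycle K rfl f (oneCocycle K S)) f fun τ => ?_
    change (f : Cochain K S p) _ * 1 = _
    rw [mul_one, map_map_op]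
    have : frontMap (rfl : p + 0 = p + 0) ≫ eqToHom (by rw [add_zero]) = 𝟙 ⦋p⦌ := by
      refine simplexHom_ext fun k => ?_
      rw [comp_val, eqToHom_val (add_zero p), frontMap_val]
      rfl
    rw [this]
    simp
  mul_assoc := by
    rintro ⟨p, a⟩ ⟨q, b⟩ ⟨r, c⟩
    obtain ⟨f, rfl⟩ := cohClass_surjective K a
    obtain ⟨g, rfl⟩ := cohClass_surjective K b
    obtain ⟨k, rfl⟩ := cohClass_surjective K c
    refine mk_cohClass_eq (add_assoc p q r) (cupCocycle K rfl (cupCocycle K rfl f g) k)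
      (cupCocycle K rfl f (cupCocycle K rfl g k)) fun τ => ?_
    change ((f : Cochain K S p) _ * (g : Cochain K S q) _) * (k : Cochain K S r) _ =
      (f : Cochain K S p) _ * ((g : Cochain K S q) _ * (k : Cochain K S r) _)
    rw [mul_assoc]
    simp only [map_map_op]
    have e1 : frontMap (rfl : p + q = p + q) ≫ frontMap (rfl : p + q + r = p + q + r) ≫
        eqToHom (by rw [add_assoc]) = frontMap (rfl : p + (q + r) = p + (q + r)) := by
      refine simplexHom_ext fun x => ?_
      simp only [comp_val, eqToHom_val (add_assoc p q r), frontMap_val]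
    have e2 : backMap (rfl : p + q = p + q) ≫ frontMap (rfl : p + q + r = p + q + r) ≫
        eqToHom (by rw [add_assoc]) =
        frontMap (rfl : q + r = q + r) ≫ backMap (rfl : p + (q + r) = p + (q + r)) := by
      refine simplexHom_ext fun x => ?_
      simp only [comp_val, eqToHom_val (add_assoc p q r), frontMap_val, backMap_val]
    have e3 : backMap (rfl : p + q + r = p + q + r) ≫ eqToHom (by rw [add_assoc]) =
        backMap (rfl : q + r = q + r) ≫ backMap (rfl : p + (q + r) = p + (q + r)) := by
      refine simplexHom_ext fun x => ?_
      simp only [comp_val, eqToHom_val (add_assoc p q r), backMap_val, add_assoc]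
    rw [e1, e2, e3]
  natCast n := n • GradedMonoid.GOne.one
  natCast_zero := zero_smul _ _
  natCast_succ n := succ_nsmul _ _
  intCast n := n • GradedMonoid.GOne.one
  intCast_ofNat n := natCast_zsmul _ _
  intCast_negSucc_ofNat n := negSucc_zsmul _ _

variable (K S)

/-- The cohomology ring `H^* = ⨁ₚ Hᵖ`, with the cup product as multiplication. -/
abbrev CohomologyRing : Type max u v := ⨁ p, Cohomology K S p

/-- The degree-`p` part of the cohomology ring. -/
def degreePart (p : ℕ) : Submodule K (CohomologyRing K S) :=
  LinearMap.range (DirectSum.lof K ℕ (Cohomology K S) p)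

/-- The positive-degree part `H^+ = ⨁_{p ≥ 1} Hᵖ` of the cohomology ring. -/
def positivePart : Submodule K (CohomologyRing K S) :=
  ⨆ p : ℕ, degreePart K S (p + 1)

end Cohomology

/-! ### Functoriality -/

section Functoriality

variable (K : Type v) [Field K] {S T : SSet.{u}} (φ : S ⟶ T)

/-- Restriction (pull-back) of cochains along a map. -/
def pullCochain (p : ℕ) : Cochain K T p →ₗ[K] Cochain K S p where
  toFun f τ := f (φ.app _ τ)
  map_add' _ _ := rfl
  map_smul' _ _ := rfl

theorem app_map_op {a b : SimplexCategory} (f : a ⟶ b) (τ : S.obj (op b)) :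
    φ.app _ (S.map f.op τ) = T.map f.op (φ.app _ τ) :=
  congrArg (fun k => k τ) (φ.naturality f.op)

theorem coboundary_pull {p : ℕ} (f : Cochain K T p) :
    coboundary K p (pullCochain K φ p f) = pullCochain K φ (p + 1) (coboundary K p f) := by
  funext τ
  simp only [coboundary, pullCochain, LinearMap.coe_mk, AddHom.coe_mk, app_map_op]

/-- Restriction of cocycles along a map. -/
def pullCocycle (p : ℕ) : Cocycle K T p →ₗ[K] Cocycle K S p :=
  (pullCochain K φ p).restrict fun f hf => by
    have hf' : coboundary K p f = 0 := hf
    change coboundary K p (pullCochain K φ p f) = 0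
    rw [coboundary_pull, hf', map_zero]

theorem pull_mem_coboundaries {p : ℕ} {f : Cochain K T p} (hf : f ∈ Coboundaries K T p) :
    pullCochain K φ p f ∈ Coboundaries K S p := by
  cases p with
  | zero =>
    have : f = 0 := hf
    simp [this]
  | succ p =>
    obtain ⟨k, rfl⟩ := hf
    exact ⟨pullCochain K φ p k, coboundary_pull K φ k⟩

/-- The map induced in cohomology of degree `p`. -/
def pullCohomology (p : ℕ) : Cohomology K T p →ₗ[K] Cohomology K S p :=
  Submodule.mapQ _ _ (pullCocycle K φ p) fun _ hf => pull_mem_coboundaries K φ hf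

theorem pullCohomology_cohClass {p : ℕ} (z : Cocycle K T p) :
    pullCohomology K φ p (cohClass K z) = cohClass K (pullCocycle K φ p z) := rfl

/-- The ring homomorphism induced in cohomology. -/
def pullRing : CohomologyRing K T →+* CohomologyRing K S :=
  DirectSum.toSemiring
    (fun p => (DirectSum.of (Cohomology K S) p).comp (pullCohomology K φ p).toAddMonoidHom)
    rfl
    (fun {p q} a b => by
      obtain ⟨f, rfl⟩ := cohClass_surjective K a
      obtain ⟨g, rfl⟩ := cohClass_surjective K b
      change _ = DirectSum.of (Cohomology K S) p (cohClass K (pullCocycle K φ p f)) *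
        DirectSum.of (Cohomology K S) q (cohClass K (pullCocycle K φ q g))
      rw [DirectSum.of_mul_of]
      change DirectSum.of (Cohomology K S) (p + q)
          (cohClass K (pullCocycle K φ (p + q) (cupCocycle K rfl f g))) =
        DirectSum.of (Cohomology K S) (p + q)
          (cohClass K (cupCocycle K rfl (pullCocycle K φ p f) (pullCocycle K φ q g)))
      congr 2
      ext τ
      change (f : Cochain K T p) (T.map _ (φ.app _ τ)) * (g : Cochain K T q) (T.map _ (φ.app _ τ)) =
        (f : Cochain K T p) (φ.app _ (S.map _ τ)) * (g : Cochain K T q) (φ.app _ (S.map _ τ))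
      rw [app_map_op, app_map_op])

theorem pullRing_of {p : ℕ} (x : Cohomology K T p) :
    pullRing K φ (DirectSum.of (Cohomology K T) p x) =
      DirectSum.of (Cohomology K S) p (pullCohomology K φ p x) :=
  DirectSum.toSemiring_of _ _ _ _ _

end Functoriality

/-! ### Length of a graded ring and the persistent cup-length invariant -/

section Invariant

/-- The length of a graded ring `R = ⨁ₚ 𝒜 p`: the largest `n` for which there are `n` homogeneous
elements of positive degree with non-zero product (`⊤` if there is no largest one, `0` if there is
no such `n` at all). -/
def gradedLength {R : Type*} [Ring R] (𝒜 : ℕ → AddSubgroup R) : ℕ∞ :=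
  sSup {ℓ : ℕ∞ | ∃ n : ℕ, ℓ = n ∧ ∃ η : Fin n → R,
    (∀ k, ∃ p : ℕ, 1 ≤ p ∧ η k ∈ 𝒜 p) ∧ (List.ofFn η).prod ≠ 0}

variable (K : Type v) [Field K]

/-- The length of the image of the ring map induced in cohomology by `φ`; the image is a subring of
`H^*(S)`, with the grading that it inherits from `H^*(S)`. -/
def imageLength {S T : SSet.{u}} (φ : S ⟶ T) : ℕ∞ :=
  gradedLength (R := (pullRing K φ).range) fun p =>
    (degreePart K S p).toAddSubgroup.comap ((pullRing K φ).range.subtype : _ →+ _)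

/-- The singular simplicial set of the space `X_t`. Its cochains, cohomology and cup product are
the singular cochains, singular cohomology and cup product of `X_t`. -/
abbrev sing (X : ℝ ⥤ TopCat.{u}) (t : ℝ) : SSet.{u} := TopCat.toSSet.obj (X.obj t)

/-- The map of singular simplicial sets induced by the transition map `X_s ⟶ X_t`, `s ≤ t`. -/
def incl (X : ℝ ⥤ TopCat.{u}) {s t : ℝ} (h : s ≤ t) : sing X s ⟶ sing X t :=
  TopCat.toSSet.map (X.map (homOfLE h))

/-- The persistent cup-length invariant: `[a, b] ↦ len (im (H^*(X_b) → H^*(X_a)))`. -/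
def persistentCupLength (X : ℝ ⥤ TopCat.{u}) {a b : ℝ} (hab : a ≤ b) : ℕ∞ :=
  imageLength K (incl X hab)

end Invariant

/-! ### Representative cocycles and the persistent cup-length diagram -/

section Diagram

/-- A family of representative cocycles for the positive-degree barcode of a persistent space `X`.

The bars, with their degrees, are indexed by `ι` (a bar may occur several times). A representative
cocycle of a bar `I` is a cocycle on `⋃_{t ∈ I} X_t`, given through its restrictions to the `X_t`,
`t ∈ I`; if `I` has a last point `d`, it amounts to a cocycle on `X_d`. Its class has to vanish
below `I`, and at each `t` the classes of the bars through `t` have to form a basis of `H^+(X_t)`.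
Thus the cocycles give a decomposition of the persistence module `H^+(X)` into the interval modules
of the bars, in other words, the bars are its barcode. -/
structure RepresentativeCocycles (K : Type v) [Field K] (X : ℝ ⥤ TopCat.{u}) where
  /-- The index set of the barcode. -/
  ι : Type w
  /-- The degree of a bar. -/
  deg : ι → ℕ
  deg_pos : ∀ i, 1 ≤ deg i
  /-- The bar itself, an interval of the real line. -/
  bar : ι → Set ℝ
  bar_nonempty : ∀ i, (bar i).Nonempty
  bar_ordConnected : ∀ i, (bar i).OrdConnected
  /-- The restriction to `X_t` of the representative cocycle. -/
  cocycle : ∀ i (t : bar i), Cocycle K (sing X t) (deg i)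
  cocycle_restrict : ∀ i (s t : bar i) (h : (s : ℝ) ≤ t),
    pullCocycle K (incl X h) (deg i) (cocycle i t) = cocycle i s
  class_eq_zero : ∀ i (t : bar i) (s : ℝ) (h : s ≤ t), s ∉ bar i →
    cohClass K (pullCocycle K (incl X h) (deg i) (cocycle i t)) = 0
  linearIndependent : ∀ t : ℝ, LinearIndependent K fun i : {i : ι // t ∈ bar i} =>
    DirectSum.of (Cohomology K (sing X t)) (deg i.1) (cohClass K (cocycle i.1 ⟨t, i.2⟩))
  span_eq : ∀ t : ℝ, Submodule.span K (Set.range fun i : {i : ι // t ∈ bar i} =>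
    DirectSum.of (Cohomology K (sing X t)) (deg i.1) (cohClass K (cocycle i.1 ⟨t, i.2⟩))) =
      positivePart K (sing X t)

variable {K : Type v} [Field K] {X : ℝ ⥤ TopCat.{u}} (σ : RepresentativeCocycles.{u, v, w} K X)

open Classical in
/-- The class `[σ_I]_t` in `H^*(X_t)` of the representative cocycle of a bar `I`. It is zero for
`t` outside `I`: below `I` this is the class of the restriction, above `I` it is a convention. -/
def RepresentativeCocycles.classAt (i : σ.ι) (t : ℝ) : CohomologyRing K (sing X t) :=
  if h : t ∈ σ.bar i then
    DirectSum.of (Cohomology K (sing X t)) (σ.deg i) (cohClass K (σ.cocycle i ⟨t, h⟩))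
  else 0

/-- The support of `σ_{I₁} ⌣ ⋯ ⌣ σ_{Iₙ}`: all `t` with `[σ_{I₁}]_t ⌣ ⋯ ⌣ [σ_{Iₙ}]_t ≠ 0`. -/
def RepresentativeCocycles.support {n : ℕ} (I : Fin n → σ.ι) : Set ℝ :=
  {t | (List.ofFn fun k => σ.classAt (I k) t).prod ≠ 0}

/-- The persistent cup-length diagram: an interval `J` goes to the largest `n ≥ 1` for which `J` is
the support of an `n`-fold product of representative cocycles (`0` if there is no such `n`, `⊤` if
there is no largest one). -/
def RepresentativeCocycles.diagram (J : Set ℝ) : ℕ∞ :=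
  sSup {ℓ : ℕ∞ | ∃ n : ℕ, 1 ≤ n ∧ ℓ = n ∧ ∃ I : Fin n → σ.ι, J = σ.support I}

/-- What is required of a finite end of an interval. -/
inductive EndKind
  | closedEnd
  | openEnd
  | anyEnd

/-- `e.Admits P`: an end may be of kind `e` if `P` says that the end belongs to the interval. -/
def EndKind.Admits : EndKind → Prop → Prop
  | .closedEnd, P => P
  | .openEnd, P => ¬ P
  | .anyEnd, _ => True

/-- The non-empty intervals of the real line, bounded or not, whose finite left end is of kind `l`
and whose finite right end is of kind `r`. -/
def Intervals (l r : EndKind) : Set (Set ℝ) :=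
  {J | J.Nonempty ∧ J.OrdConnected ∧ (∀ x, IsGLB J x → l.Admits (x ∈ J)) ∧
    (∀ x, IsLUB J x → r.Admits (x ∈ J))}

end Diagram

end PersistentCup

end

/-!
A homogeneous element of the image of `H^*(X_b) → H^*(X_a)` lifts to a homogeneous element of
`H^*(X_b)`, hence to a linear combination of the cocycles whose bars contain `b`. By multilinearity,
a non-zero product of `n` such elements yields `n` of these cocycles whose product is non-zero at
`a`, and then also on all of `[a, b]`. So the cup-length of `[a, b]` is the supremum of the `n` for
which the support of some `n`-fold product of cocycles contains `[a, b]`.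

It remains to see that a non-empty support is an interval of the same kind as the bars. Let `t` be
one of its points. Beyond `t` the product vanishes only where one of the factors does, so there the
support is the intersection of the bars of the factors. Before `t` it is the union of the finitely
many bars that occur when the product at `t` is expanded in the basis. A finite end of a finite
union or intersection of intervals is an end of one of these intervals.
-/

namespace PersistentCup

section SpanProd

open Submodule

open scoped Pointwise in
theorem exists_apply_prod_ne_zero_of_mem_span {R A M : Type*} [CommSemiring R] [Semiring A]
    [Algebra R A] [AddCommMonoid M] [Module R M] (f : A →ₗ[R] M) {s : Set A} {n : ℕ}
    {y : Fin n → A} (hy : ∀ k, y k ∈ span R s) (hne : f (List.ofFn y).prod ≠ 0) :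
    ∃ v : Fin n → s, f (List.ofFn fun k => (v k : A)).prod ≠ 0 := by
  contrapose! hne
  have hprod : (List.ofFn y).prod ∈ span R (s ^ n) := by
    rw [← span_pow]
    exact pow_subset_pow _ (Set.mem_pow.2 ⟨fun k => ⟨y k, hy k⟩, rfl⟩)
  have hker : span R (s ^ n) ≤ LinearMap.ker f := by
    refine span_le.2 fun z hz => ?_
    obtain ⟨v, rfl⟩ := Set.mem_pow.1 hz
    exact hne v
  exact hker hprod

theorem linearCombination_eq_zero_iff_of_linearIndepOn {R M ι : Type*} [Ring R] [AddCommGroup M]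
    [Module R M] {v : ι → M} {A : Set ι} (hv : LinearIndepOn R v A) (hA : ∀ i ∉ A, v i = 0)
    (c : ι →₀ R) : Finsupp.linearCombination R v c = 0 ↔ ∀ i ∈ A, c i = 0 := by
  classical
  have hrestrict : Finsupp.linearCombination R v c =
      Finsupp.linearCombination R v (c.filter (· ∈ A)) := by
    conv_lhs => rw [← c.filter_add_filter_not (· ∈ A), map_add]
    rw [add_eq_left, Finsupp.linearCombination_apply]
    refine Finset.sum_eq_zero fun i hi => ?_
    rw [Finsupp.support_filter, Finset.mem_filter] at hi
    change _ • v i = 0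
    rw [hA i hi.2, smul_zero]
  have hfilter : c.filter (· ∈ A) ∈ Finsupp.supported R R A := fun i hi =>
    (Finset.mem_filter.1 (Finsupp.support_filter (· ∈ A) c ▸ hi)).2
  rw [hrestrict]
  refine ⟨fun h i hi => ?_, fun h => ?_⟩
  · rw [← c.filter_apply_pos (· ∈ A) hi, linearIndepOn_iff.1 hv _ hfilter h, Finsupp.zero_apply]
  · rw [Finsupp.filter_eq_zero_iff _ _ |>.2 h, map_zero]

end SpanProd

section Ends

variable {α : Type*} [LinearOrder α]

theorem lowerBounds_inter_Iic_of_mem {s : Set α} {t : α} (ht : t ∈ s) :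
    lowerBounds (s ∩ Set.Iic t) = lowerBounds s := by
  refine (lowerBounds_mono_set Set.inter_subset_left).antisymm' fun x hx y hy => ?_
  rcases le_total y t with hyt | hty
  · exact hx ⟨hy, hyt⟩
  · exact (hx ⟨ht, le_rfl⟩).trans hty

theorem exists_isGLB_of_isGLB_biUnion {ι : Type*} {F : Finset ι} {A : ι → Set α} {x : α}
    (hne : (⋃ i ∈ F, A i).Nonempty) (hx : IsGLB (⋃ i ∈ F, A i) x) : ∃ i ∈ F, IsGLB (A i) x := by
  have hlow : ∀ i ∈ F, x ∈ lowerBounds (A i) := fun i hi y hy => hx.1 (Set.mem_biUnion hi hy)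
  by_contra! hnot
  have hgap : ∀ i ∈ F, ∃ y ∈ lowerBounds (A i), x < y := by
    intro i hi
    by_contra! hy
    exact hnot i hi ⟨hlow i hi, hy⟩
  have : Nonempty α := ⟨x⟩
  choose! y hy hxy using hgap
  have hF : F.Nonempty := by
    obtain ⟨z, hz⟩ := hne
    obtain ⟨i, hi, -⟩ := Set.mem_iUnion₂.1 hz
    exact ⟨i, hi⟩
  obtain ⟨j, hj, hmin⟩ := F.exists_min_image y hF
  refine (hxy j hj).not_ge (hx.2 fun z hz => ?_)
  obtain ⟨i, hi, hzi⟩ := Set.mem_iUnion₂.1 hz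
  exact (hmin i hi).trans (hy i hi hzi)

theorem exists_isLUB_of_isLUB_iInter {ι : Type*} [Finite ι] [Nonempty ι] {A : ι → Set α}
    (hA : ∀ i, (A i).OrdConnected) {x : α} (hne : (⋂ i, A i).Nonempty)
    (hx : IsLUB (⋂ i, A i) x) : ∃ i, IsLUB (A i) x := by
  obtain ⟨t, ht⟩ := hne
  have hleast : ∀ i, x ∈ lowerBounds (upperBounds (A i)) := fun i y hy =>
    hx.2 fun z hz => hy (Set.mem_iInter.1 hz i)
  by_contra! hnot
  have hgap : ∀ i, ∃ y ∈ A i, x < y := by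
    intro i
    by_contra! hy
    exact hnot i ⟨hy, hleast i⟩
  choose y hy hxy using hgap
  obtain ⟨j, hmin⟩ := Finite.exists_min y
  refine (hxy j).not_ge (hx.1 (Set.mem_iInter.2 fun i => ?_))
  exact (hA i).out (Set.mem_iInter.1 ht i) (hy i) ⟨(hx.1 ht).trans (hxy j).le, hmin i⟩

/-- A greatest lower bound of `J`, if there is one, is an end of kind `l`. This is the condition on
left ends in `Intervals`, in any order. -/
def HasLeftEnd (l : EndKind) (J : Set α) : Prop :=
  ∀ x, IsGLB J x → l.Admits (x ∈ J)

/-- A least upper bound of `J`, if there is one, is an end of kind `r`. This is the condition on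
right ends in `Intervals`, in any order. -/
def HasRightEnd (r : EndKind) (J : Set α) : Prop :=
  ∀ x, IsLUB J x → r.Admits (x ∈ J)

theorem HasLeftEnd.of_inter_Iic_eq {l : EndKind} {J J' : Set α} {t : α} (hJ' : HasLeftEnd l J')
    (ht : t ∈ J) (h : J ∩ Set.Iic t = J' ∩ Set.Iic t) : HasLeftEnd l J := by
  intro x hx
  have hmem : ∀ s ≤ t, s ∈ J ↔ s ∈ J' := fun s hs => by
    simpa only [Set.mem_inter_iff, Set.mem_Iic, hs, and_true] using Set.ext_iff.1 h s
  have hx' : IsGLB J' x := by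
    rwa [IsGLB, ← lowerBounds_inter_Iic_of_mem ((hmem t le_rfl).1 ht), ← h,
      lowerBounds_inter_Iic_of_mem ht]
  rw [hmem x (hx.1 ht)]
  exact hJ' x hx'

theorem HasRightEnd.of_inter_Ici_eq {r : EndKind} {J J' : Set α} {t : α} (hJ' : HasRightEnd r J')
    (ht : t ∈ J) (h : J ∩ Set.Ici t = J' ∩ Set.Ici t) : HasRightEnd r J :=
  HasLeftEnd.of_inter_Iic_eq (α := αᵒᵈ) hJ' ht h

theorem HasLeftEnd.biUnion {l : EndKind} {ι : Type*} {F : Finset ι} {A : ι → Set α}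
    (hA : ∀ i ∈ F, HasLeftEnd l (A i)) (hne : (⋃ i ∈ F, A i).Nonempty) :
    HasLeftEnd l (⋃ i ∈ F, A i) := by
  intro x hx
  cases l with
  | anyEnd => trivial
  | openEnd =>
    intro hxA
    obtain ⟨i, hi, hxi⟩ := Set.mem_iUnion₂.1 hxA
    have hleast : IsLeast (A i) x := ⟨hxi, fun y hy => hx.1 (Set.mem_biUnion hi hy)⟩
    exact hA i hi x hleast.isGLB hxi
  | closedEnd =>
    obtain ⟨i, hi, hxi⟩ := exists_isGLB_of_isGLB_biUnion hne hx
    exact Set.mem_biUnion hi (hA i hi x hxi)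

theorem HasRightEnd.iInter {r : EndKind} {ι : Type*} [Finite ι] [Nonempty ι] {A : ι → Set α}
    (hconn : ∀ i, (A i).OrdConnected) (hA : ∀ i, HasRightEnd r (A i)) (hne : (⋂ i, A i).Nonempty) :
    HasRightEnd r (⋂ i, A i) := by
  intro x hx
  cases r with
  | anyEnd => trivial
  | openEnd =>
    intro hxA
    obtain ⟨i, hxi⟩ := exists_isLUB_of_isLUB_iInter hconn hne hx
    exact hA i x hxi (Set.mem_iInter.1 hxA i)
  | closedEnd =>
    obtain ⟨t, ht⟩ := hne
    refine Set.mem_iInter.2 fun i => ?_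
    by_contra hxi
    have hup : x ∈ upperBounds (A i) := by
      intro y hy
      by_contra! hxy
      exact hxi ((hconn i).out (Set.mem_iInter.1 ht i) hy ⟨hx.1 ht, hxy.le⟩)
    exact hxi (hA i x ⟨hup, fun y hy => hx.2 fun z hz => hy (Set.mem_iInter.1 hz i)⟩)

theorem univ_mem_Intervals (l r : EndKind) : Set.univ ∈ Intervals l r :=
  ⟨Set.univ_nonempty, Set.ordConnected_univ, fun x hx => absurd ⟨x, hx.1⟩ not_bddBelow_univ,
    fun x hx => absurd ⟨x, hx.1⟩ not_bddAbove_univ⟩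

end Ends

section Algebra

variable {K : Type v} [Field K] {S T : SSet.{u}}

theorem smul_gradedMonoid_mul (c : K) (x y : GradedMonoid (Cohomology K S)) :
    (c • x) * y = c • (x * y) :=
  congrArg (GradedMonoid.mk (x.1 + y.1)) (LinearMap.map_smul₂ (cup K rfl) c x.2 y.2)

theorem gradedMonoid_mul_smul (c : K) (x y : GradedMonoid (Cohomology K S)) :
    x * (c • y) = c • (x * y) :=
  congrArg (GradedMonoid.mk (x.1 + y.1)) (map_smul (cup K rfl x.2) c y.2)

noncomputable instance : DirectSum.GAlgebra K (Cohomology K S) where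
  toFun := (LinearMap.toSpanSingleton K (Cohomology K S 0) GradedMonoid.GOne.one).toAddMonoidHom
  map_one := one_smul K (GradedMonoid.GOne.one : Cohomology K S 0)
  map_mul c d := by
    change (c * d) • (1 : GradedMonoid (Cohomology K S)) = (c • 1) * (d • 1)
    rw [smul_gradedMonoid_mul, one_mul, mul_smul]
  commutes c x := by
    change (c • 1) * x = x * (c • 1)
    rw [smul_gradedMonoid_mul, gradedMonoid_mul_smul, one_mul, mul_one]
  smul_def c x := by
    change c • x = (c • 1) * x
    rw [smul_gradedMonoid_mul, one_mul]

instance : SetLike.GradedMonoid (degreePart K S) where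
  one_mem := ⟨GradedMonoid.GOne.one, rfl⟩
  mul_mem := by
    rintro p q _ _ ⟨x, rfl⟩ ⟨y, rfl⟩
    exact ⟨GradedMonoid.GMul.mul x y, (DirectSum.of_mul_of x y).symm⟩

theorem degreePart_le_positivePart {p : ℕ} (hp : 1 ≤ p) : degreePart K S p ≤ positivePart K S := by
  obtain ⟨q, rfl⟩ := Nat.exists_eq_add_of_le' hp
  exact le_iSup (fun q => degreePart K S (q + 1)) q

theorem prod_ofFn_mem_positivePart {n : ℕ} (hn : 1 ≤ n) {d : Fin n → ℕ} (hd : ∀ k, 1 ≤ d k)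
    {x : Fin n → CohomologyRing K S} (hx : ∀ k, x k ∈ degreePart K S (d k)) :
    (List.ofFn x).prod ∈ positivePart K S := by
  refine degreePart_le_positivePart ?_ (SetLike.list_prod_ofFn_mem_graded d x hx)
  rw [List.sum_ofFn]
  exact (hd ⟨0, hn⟩).trans (Finset.single_le_sum_of_canonicallyOrdered (Finset.mem_univ _))

theorem pullRing_eq_lmap (φ : S ⟶ T) (x : CohomologyRing K T) :
    pullRing K φ x = DirectSum.lmap (pullCohomology K φ) x := by
  induction x using DirectSum.induction_on with
  | zero => rw [map_zero, map_zero]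
  | add x y hx hy => rw [map_add, map_add, hx, hy]
  | of p x => rw [pullRing_of, DirectSum.lmap_of]

theorem exists_mem_degreePart_pullRing_eq (φ : S ⟶ T) {p : ℕ} {x : CohomologyRing K S}
    (hx : x ∈ degreePart K S p) (hrange : x ∈ (pullRing K φ).range) :
    ∃ y ∈ degreePart K T p, pullRing K φ y = x := by
  obtain ⟨x, rfl⟩ := hx
  obtain ⟨z, hz⟩ := hrange
  refine ⟨DirectSum.lof K ℕ _ p (z p), ⟨z p, rfl⟩, ?_⟩
  rw [pullRing_eq_lmap, DirectSum.lmap_lof, ← DirectSum.lmap_apply, ← pullRing_eq_lmap, hz,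
    DirectSum.lof_apply]

theorem imageLength_eq_sSup_pullRing_prod_ne_zero (φ : S ⟶ T) :
    imageLength K φ = sSup {ℓ : ℕ∞ | ∃ n : ℕ, ℓ = n ∧ ∃ y : Fin n → CohomologyRing K T,
      (∀ k, ∃ p : ℕ, 1 ≤ p ∧ y k ∈ degreePart K T p) ∧ pullRing K φ (List.ofFn y).prod ≠ 0} := by
  have coe_prod : ∀ {n : ℕ} (η : Fin n → (pullRing K φ).range) (y : Fin n → CohomologyRing K T),
      (∀ k, pullRing K φ (y k) = η k) →
        ((List.ofFn η).prod : CohomologyRing K S) = pullRing K φ (List.ofFn y).prod := by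
    intro n η y hy
    rw [SubmonoidClass.coe_list_prod, map_list_prod, List.map_ofFn, List.map_ofFn]
    exact congrArg (fun f => (List.ofFn f).prod) (funext fun k => (hy k).symm)
  refine congrArg sSup (Set.ext fun ℓ => exists_congr fun n => and_congr_right fun _ => ⟨?_, ?_⟩)
  · rintro ⟨η, hη, hne⟩
    choose p hp hmem using hη
    choose y hy hyη using fun k => exists_mem_degreePart_pullRing_eq φ (hmem k) (η k).2
    refine ⟨y, fun k => ⟨p k, hp k, hy k⟩, ?_⟩
    rwa [← coe_prod η y hyη, Ne, ZeroMemClass.coe_eq_zero]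
  · rintro ⟨y, hy, hne⟩
    refine ⟨fun k => ⟨pullRing K φ (y k), y k, rfl⟩, fun k => ?_, fun h0 => hne ?_⟩
    · obtain ⟨p, hp, z, hz⟩ := hy k
      refine ⟨p, hp, pullCohomology K φ p z, ?_⟩
      change _ = pullRing K φ (y k)
      rw [← hz]
      exact (pullRing_of K φ z).symm
    · exact (coe_prod _ y fun _ => rfl).symm.trans (congrArg Subtype.val h0)

end Algebra

namespace RepresentativeCocycles

variable {K : Type v} [Field K] {X : ℝ ⥤ TopCat.{u}} (σ : RepresentativeCocycles.{u, v, w} K X)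

theorem classAt_of_mem {i : σ.ι} {t : ℝ} (h : t ∈ σ.bar i) :
    σ.classAt i t =
      DirectSum.of (Cohomology K (sing X t)) (σ.deg i) (cohClass K (σ.cocycle i ⟨t, h⟩)) :=
  dif_pos h

theorem classAt_of_notMem {i : σ.ι} {t : ℝ} (h : t ∉ σ.bar i) : σ.classAt i t = 0 :=
  dif_neg h

theorem classAt_mem_degreePart (i : σ.ι) (t : ℝ) :
    σ.classAt i t ∈ degreePart K (sing X t) (σ.deg i) := by
  by_cases h : t ∈ σ.bar i
  · rw [σ.classAt_of_mem h]
    exact ⟨_, rfl⟩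
  · rw [σ.classAt_of_notMem h]
    exact zero_mem _

theorem linearIndepOn_classAt (t : ℝ) :
    LinearIndepOn K (fun i => σ.classAt i t) {i | t ∈ σ.bar i} := by
  have hfamily := funext fun i : {i : σ.ι // t ∈ σ.bar i} => σ.classAt_of_mem i.2
  have hindep := σ.linearIndependent t
  rwa [← hfamily] at hindep

theorem span_classAt (t : ℝ) :
    Submodule.span K ((fun i => σ.classAt i t) '' {i | t ∈ σ.bar i}) =
      positivePart K (sing X t) := by
  have hfamily := funext fun i : {i : σ.ι // t ∈ σ.bar i} => σ.classAt_of_mem i.2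
  rw [← σ.span_eq t, Set.image_eq_range]
  exact congrArg (fun f => Submodule.span K (Set.range f)) hfamily

section Restriction

variable {s t : ℝ} (hst : s ≤ t)
include hst

theorem pullRing_classAt {i : σ.ι} (ht : t ∈ σ.bar i) :
    pullRing K (incl X hst) (σ.classAt i t) = σ.classAt i s := by
  rw [σ.classAt_of_mem ht, pullRing_of, pullCohomology_cohClass]
  by_cases hs : s ∈ σ.bar i
  · rw [σ.classAt_of_mem hs, σ.cocycle_restrict i ⟨s, hs⟩ ⟨t, ht⟩ hst]
  · rw [σ.classAt_of_notMem hs, σ.class_eq_zero i ⟨t, ht⟩ s hst hs, map_zero]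

theorem pullRing_prod_classAt {n : ℕ} {I : Fin n → σ.ι} (ht : ∀ k, t ∈ σ.bar (I k)) :
    pullRing K (incl X hst) (List.ofFn fun k => σ.classAt (I k) t).prod =
      (List.ofFn fun k => σ.classAt (I k) s).prod := by
  rw [map_list_prod, List.map_ofFn]
  exact congrArg (fun f => (List.ofFn f).prod) (funext fun k => σ.pullRing_classAt hst (ht k))

theorem pullRing_linearCombination_classAt {c : σ.ι →₀ K}
    (hc : ∀ i ∈ c.support, t ∈ σ.bar i) :
    pullRing K (incl X hst) (Finsupp.linearCombination K (fun i => σ.classAt i t) c) =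
      Finsupp.linearCombination K (fun i => σ.classAt i s) c := by
  rw [pullRing_eq_lmap, Finsupp.linearCombination_apply, Finsupp.linearCombination_apply,
    map_finsuppSum]
  refine Finsupp.sum_congr fun i hi => ?_
  rw [map_smul, ← pullRing_eq_lmap, σ.pullRing_classAt hst (hc i hi)]

end Restriction

section Support

variable {n : ℕ} {I : Fin n → σ.ι} {t : ℝ}

theorem mem_bar_of_mem_support (ht : t ∈ σ.support I) (k : Fin n) : t ∈ σ.bar (I k) := by
  by_contra hk
  exact ht (List.prod_eq_zero (List.mem_ofFn.2 ⟨k, σ.classAt_of_notMem hk⟩))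

theorem support_inter_Ici (ht : t ∈ σ.support I) :
    σ.support I ∩ Set.Ici t = (⋂ k, σ.bar (I k)) ∩ Set.Ici t := by
  ext u
  refine and_congr_left fun htu => ⟨fun hu => Set.mem_iInter.2 (σ.mem_bar_of_mem_support hu), ?_⟩
  intro hu hzero
  refine ht ?_
  rw [← σ.pullRing_prod_classAt htu (Set.mem_iInter.1 hu), hzero, map_zero]

theorem mem_support_of_le (ht : t ∈ σ.support I) {u : ℝ} (htu : t ≤ u)
    (hu : ∀ k, u ∈ σ.bar (I k)) : u ∈ σ.support I :=
  ((σ.support_inter_Ici ht).symm.subset ⟨Set.mem_iInter.2 hu, htu⟩).1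

theorem ordConnected_support (I : Fin n → σ.ι) : (σ.support I).OrdConnected :=
  ⟨fun _ hs _ ht _ hx => σ.mem_support_of_le hs hx.1 fun k =>
    (σ.bar_ordConnected (I k)).out (σ.mem_bar_of_mem_support hs k)
      (σ.mem_bar_of_mem_support ht k) hx⟩

theorem Icc_subset_support_iff {a b : ℝ} (hab : a ≤ b) :
    Set.Icc a b ⊆ σ.support I ↔ a ∈ σ.support I ∧ ∀ k, b ∈ σ.bar (I k) := by
  constructor
  · intro h
    exact ⟨h (Set.left_mem_Icc.2 hab), σ.mem_bar_of_mem_support (h (Set.right_mem_Icc.2 hab))⟩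
  · rintro ⟨ha, hb⟩
    exact (σ.ordConnected_support I).out ha (σ.mem_support_of_le ha hab hb)

theorem exists_linearCombination_eq_prod_classAt (hn : 1 ≤ n) (I : Fin n → σ.ι) (t : ℝ) :
    ∃ c : σ.ι →₀ K, (∀ i ∈ c.support, t ∈ σ.bar i) ∧
      Finsupp.linearCombination K (fun i => σ.classAt i t) c =
        (List.ofFn fun k => σ.classAt (I k) t).prod := by
  have hpos := prod_ofFn_mem_positivePart hn (fun k => σ.deg_pos (I k))
    (fun k => σ.classAt_mem_degreePart (I k) t)
  rw [← σ.span_classAt t, Finsupp.mem_span_image_iff_linearCombination] at hpos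
  obtain ⟨c, hc, heq⟩ := hpos
  exact ⟨c, fun i hi => hc hi, heq⟩

theorem exists_support_inter_Iic (hn : 1 ≤ n) (ht : t ∈ σ.support I) :
    ∃ F : Finset σ.ι, σ.support I ∩ Set.Iic t = (⋃ i ∈ F, σ.bar i) ∩ Set.Iic t := by
  obtain ⟨c, hc, heq⟩ := σ.exists_linearCombination_eq_prod_classAt hn I t
  refine ⟨c.support, Set.ext fun s => and_congr_left fun hst => ?_⟩
  have hrestrict : (List.ofFn fun k => σ.classAt (I k) s).prod =
      Finsupp.linearCombination K (fun i => σ.classAt i s) c := by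
    rw [← σ.pullRing_prod_classAt hst (σ.mem_bar_of_mem_support ht), ← heq,
      σ.pullRing_linearCombination_classAt hst hc]
  have hzero := linearCombination_eq_zero_iff_of_linearIndepOn (σ.linearIndepOn_classAt s)
    (fun i hi => σ.classAt_of_notMem hi) c
  change (List.ofFn fun k => σ.classAt (I k) s).prod ≠ 0 ↔ _
  rw [hrestrict, Ne, hzero]
  simp only [Set.mem_ofPred_eq, not_forall, Set.mem_iUnion, Finsupp.mem_support_iff, exists_prop,
    and_comm, ne_eq]

theorem hasLeftEnd_support {l : EndKind} (hl : ∀ i, HasLeftEnd l (σ.bar i)) (hn : 1 ≤ n)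
    (hI : (σ.support I).Nonempty) : HasLeftEnd l (σ.support I) := by
  obtain ⟨t, ht⟩ := hI
  obtain ⟨F, hF⟩ := σ.exists_support_inter_Iic hn ht
  have htF : t ∈ ⋃ i ∈ F, σ.bar i := (hF.subset ⟨ht, Set.self_mem_Iic⟩).1
  exact (HasLeftEnd.biUnion (fun i _ => hl i) ⟨t, htF⟩).of_inter_Iic_eq ht hF

theorem hasRightEnd_support {r : EndKind} (hr : ∀ i, HasRightEnd r (σ.bar i)) (hn : 1 ≤ n)
    (hI : (σ.support I).Nonempty) : HasRightEnd r (σ.support I) := by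
  obtain ⟨t, ht⟩ := hI
  have : Nonempty (Fin n) := ⟨⟨0, hn⟩⟩
  have htI : t ∈ ⋂ k, σ.bar (I k) := Set.mem_iInter.2 (σ.mem_bar_of_mem_support ht)
  exact (HasRightEnd.iInter (fun k => σ.bar_ordConnected (I k)) (fun k => hr (I k))
    ⟨t, htI⟩).of_inter_Ici_eq ht (σ.support_inter_Ici ht)

theorem support_mem_Intervals {l r : EndKind} (hσ : ∀ i, σ.bar i ∈ Intervals l r) (hn : 1 ≤ n)
    (hI : (σ.support I).Nonempty) : σ.support I ∈ Intervals l r :=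
  ⟨hI, σ.ordConnected_support I, σ.hasLeftEnd_support (fun i => (hσ i).2.2.1) hn hI,
    σ.hasRightEnd_support (fun i => (hσ i).2.2.2) hn hI⟩

end Support

section CupLength

variable {a b : ℝ} (hab : a ≤ b)

theorem exists_Icc_subset_support {n : ℕ} {y : Fin n → CohomologyRing K (sing X b)}
    (hy : ∀ k, y k ∈ positivePart K (sing X b))
    (hne : pullRing K (incl X hab) (List.ofFn y).prod ≠ 0) :
    ∃ I : Fin n → σ.ι, Set.Icc a b ⊆ σ.support I := by
  simp only [← σ.span_classAt b] at hy
  rw [pullRing_eq_lmap] at hne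
  obtain ⟨v, hv⟩ := exists_apply_prod_ne_zero_of_mem_span _ hy hne
  choose I hbI hIv using fun k => (v k).2
  refine ⟨I, (σ.Icc_subset_support_iff hab).2 ⟨?_, hbI⟩⟩
  change (List.ofFn fun k => σ.classAt (I k) a).prod ≠ 0
  simp only [← hIv] at hv
  rwa [← pullRing_eq_lmap, σ.pullRing_prod_classAt hab hbI] at hv

theorem persistentCupLength_eq_sSup_Icc_subset_support :
    persistentCupLength K X hab =
      sSup {ℓ : ℕ∞ | ∃ n : ℕ, ℓ = n ∧ ∃ I : Fin n → σ.ι, Set.Icc a b ⊆ σ.support I} := by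
  rw [persistentCupLength, imageLength_eq_sSup_pullRing_prod_ne_zero]
  refine congrArg sSup (Set.ext fun ℓ => exists_congr fun n => and_congr_right fun _ => ⟨?_, ?_⟩)
  · rintro ⟨y, hy, hne⟩
    refine σ.exists_Icc_subset_support hab (fun k => ?_) hne
    obtain ⟨p, hp, hyp⟩ := hy k
    exact degreePart_le_positivePart hp hyp
  · rintro ⟨I, hI⟩
    obtain ⟨ha, hb⟩ := (σ.Icc_subset_support_iff hab).1 hI
    refine ⟨fun k => σ.classAt (I k) b,
      fun k => ⟨σ.deg (I k), σ.deg_pos (I k), σ.classAt_mem_degreePart (I k) b⟩, ?_⟩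
    rw [σ.pullRing_prod_classAt hab hb]
    exact ha

theorem persistentCupLength_eq_iSup_diagram {𝒥 : Set (Set ℝ)}
    (h𝒥 : ∀ {n : ℕ} {I : Fin n → σ.ι}, 1 ≤ n → (σ.support I).Nonempty → σ.support I ∈ 𝒥) :
    persistentCupLength K X hab = ⨆ J ∈ {J | J ∈ 𝒥 ∧ Set.Icc a b ⊆ J}, σ.diagram J := by
  rw [σ.persistentCupLength_eq_sSup_Icc_subset_support hab]
  refine le_antisymm (sSup_le ?_) (iSup₂_le fun J hJ => sSup_le ?_)
  · rintro _ ⟨n, rfl, I, hI⟩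
    rcases Nat.eq_zero_or_pos n with rfl | hn
    · exact zero_le
    · have hmem := h𝒥 hn ⟨a, hI (Set.left_mem_Icc.2 hab)⟩
      exact le_iSup₂_of_le (σ.support I) ⟨hmem, hI⟩ (le_sSup ⟨n, hn, rfl, I, rfl⟩)
  · rintro _ ⟨n, -, rfl, I, rfl⟩
    exact le_sSup ⟨n, rfl, I, hJ.2⟩

end CupLength

end RepresentativeCocycles

end PersistentCup

theorem mainTheorem8 {K : Type v} [Field K] (X : ℝ ⥤ TopCat.{u})
    (σ : PersistentCup.RepresentativeCocycles.{u, v, w} K X) (l r : PersistentCup.EndKind)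
    (hσ : ∀ i, σ.bar i ∈ PersistentCup.Intervals l r) (a b : ℝ) (hab : a ≤ b) :
    (PersistentCup.persistentCupLength K X hab =
      ⨆ J ∈ {J | J ∈ PersistentCup.Intervals l r ∧ Set.Icc a b ⊆ J}, σ.diagram J) ∧
    (PersistentCup.persistentCupLength K X hab ≠ ⊤ →
      IsGreatest (σ.diagram '' {J | J ∈ PersistentCup.Intervals l r ∧ Set.Icc a b ⊆ J})
        (PersistentCup.persistentCupLength K X hab)) := by
  have hsup := σ.persistentCupLength_eq_iSup_diagram hab (σ.support_mem_Intervals hσ)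
  refine ⟨hsup, fun hfin => ?_⟩
  rw [← sSup_image] at hsup
  have : Nonempty (σ.diagram '' {J | J ∈ PersistentCup.Intervals l r ∧ Set.Icc a b ⊆ J}) :=
    ⟨_, Set.univ, ⟨PersistentCup.univ_mem_Intervals l r, Set.subset_univ _⟩, rfl⟩
  rw [hsup] at hfin ⊢
  exact ⟨ENat.sSup_mem_of_nonempty_of_lt_top hfin.lt_top, fun _ => le_sSup⟩
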